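/- Let $\ell^2$ be the complex Hilbert space of square-summable sequences $z=(z_j)_{j\ge1}$, $z_j=x_j+\sqrt{-1}\,y_j\in\mathbb C$, and let $V\subset\ell^2$ be open. A set $S$ is *uniformly included* in $V$, written $S\stackrel{\circ}{\subset}V$, if $S$ is a nonempty bounded subset of $V$ and $d(S,\partial V)=\inf\{\|z-w\|: z\in S,\ w\in\partial V\}>0$, where $d(S,\partial V)=+\infty$ if $V=\ell^2$. For $f:V\to\mathbb C$, let $\frac{\partial f}{\partial x_j}(z)$ and $\frac{\partial f}{\partial y_j}(z)$ be the derivatives at $\tau=0$ of the functions of the real variable $\tau$ obtained by replacing the coordinate $z_j$ of $z$ in $f(z)$ by $z_j+\tau$, respectively by $z_j+\sqrt{-1}\,\tau$, and put $\partial_j=\frac12\big(\frac{\partial}{\partial x_j}-\sqrt{-1}\frac{\partial}{\partial y_j}\big)$ and $\overline\partial_j=\frac12\big(\frac{\partial}{\partial x_j}+\sqrt{-1}\frac{\partial}{\partial y_j}\big)$. Define the following sets of functions $f:V\to\mathbb C$. * $C^1(V)$ is the set of all continuous $f$ whose partial derivatives $\frac{\partial f}{\partial x_j},\frac{\partial f}{\partial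 y_j}$ ($j\ge1$) all exist and are continuous on $V$. * $\mathrm{Lip}(V)$ is the set of all $f$ such that for each $S\stackrel{\circ}{\subset}V$ there is a constant $C(S)>0$ with $|f(z)-f(w)|\le C(S)\,\|z-w\|$ for all $z,w\in S$. * $C^1_F(V)$ is the set of all $f\in C^1(V)$ such that $\displaystyle\sup_{z\in S}\Big\{|f(z)|+\sum_{j=1}^\infty\big(|\partial_jf(z)|^2+|\overline\partial_jf(z)|^2\big)\Big\}<\infty$ for each $S\stackrel{\circ}{\subset}V$. Then $$C^1(V)\cap\mathrm{Lip}(V)=C^1_F(V).$$ -/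

import Mathlib

open scoped ENNReal

noncomputable section

namespace EllTwo

/-- The complex Hilbert space `ℓ²` of square-summable complex sequences (indexed by `0, 1, 2, …`). -/
abbrev Ell2 : Type := lp (fun _ : ℕ => ℂ) 2

/-- The distance `d(S, ∂V) ∈ [0, +∞]`, the infimum of `‖z - w‖` over `z ∈ S` and `w ∈ ∂V`.
If `V` is the whole space then `∂V = ∅` and the infimum is `+∞`. -/
def distToFrontier (S V : Set Ell2) : ℝ≥0∞ :=
  ⨅ z ∈ S, ⨅ w ∈ frontier V, edist z w

/-- `S` is uniformly included in `V`: it is a nonempty bounded subset of `V` lying at positive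
distance from the boundary of `V`. -/
def UniformlyIncluded (S V : Set Ell2) : Prop :=
  S.Nonempty ∧ Bornology.IsBounded S ∧ S ⊆ V ∧ 0 < distToFrontier S V

/-- `τ ↦ f (z₁, …, z_{j-1}, z_j + τ, z_{j+1}, …)` for real `τ`. -/
def sliceX (f : Ell2 → ℂ) (j : ℕ) (z : Ell2) (τ : ℝ) : ℂ :=
  f (z + lp.single 2 j (τ : ℂ))

/-- `τ ↦ f (z₁, …, z_{j-1}, z_j + i τ, z_{j+1}, …)` for real `τ`. -/
def sliceY (f : Ell2 → ℂ) (j : ℕ) (z : Ell2) (τ : ℝ) : ℂ :=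
  f (z + lp.single 2 j (Complex.I * (τ : ℂ)))

/-- The partial derivative `∂f/∂x_j` at `z`, with `z_j = x_j + i y_j`. -/
def partialX (f : Ell2 → ℂ) (j : ℕ) (z : Ell2) : ℂ := deriv (sliceX f j z) 0

/-- The partial derivative `∂f/∂y_j` at `z`, with `z_j = x_j + i y_j`. -/
def partialY (f : Ell2 → ℂ) (j : ℕ) (z : Ell2) : ℂ := deriv (sliceY f j z) 0

/-- `∂_j = (∂/∂x_j - i ∂/∂y_j) / 2`. -/
def dz (f : Ell2 → ℂ) (j : ℕ) (z : Ell2) : ℂ :=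
  (1 / 2 : ℂ) * (partialX f j z - Complex.I * partialY f j z)

/-- `∂̄_j = (∂/∂x_j + i ∂/∂y_j) / 2`. -/
def dzbar (f : Ell2 → ℂ) (j : ℕ) (z : Ell2) : ℂ :=
  (1 / 2 : ℂ) * (partialX f j z + Complex.I * partialY f j z)

/-!
Functions on an open set `V` are represented by functions on the whole space. Membership in each
of the classes below depends only on the restriction of the function to `V`.
-/

/-- `C¹(V)`: `f` is continuous on `V`, and all partial derivatives `∂f/∂x_j`, `∂f/∂y_j`
exist at every point of `V` and are continuous on `V`. -/
def C1 (V : Set Ell2) : Set (Ell2 → ℂ) :=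
  {f | ContinuousOn f V ∧
    ∀ j : ℕ,
      (∀ z ∈ V, DifferentiableAt ℝ (sliceX f j z) 0 ∧ DifferentiableAt ℝ (sliceY f j z) 0) ∧
      ContinuousOn (partialX f j) V ∧ ContinuousOn (partialY f j) V}

/-- `Lip(V)`: `f` is Lipschitz on each set uniformly included in `V`, with a constant that may
depend on that set. -/
def LipUI (V : Set Ell2) : Set (Ell2 → ℂ) :=
  {f | ∀ S : Set Ell2, UniformlyIncluded S V →
    ∃ C : ℝ, 0 < C ∧ ∀ z ∈ S, ∀ w ∈ S, ‖f z - f w‖ ≤ C * ‖z - w‖}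

/-- `C¹_F(V)`: the functions in `C¹(V)` for which `|f| + ∑_j (|∂_j f|² + |∂̄_j f|²)` is bounded on
each set uniformly included in `V`. The sum and the supremum are taken in `[0, +∞]`. -/
def C1F (V : Set Ell2) : Set (Ell2 → ℂ) :=
  {f | f ∈ C1 V ∧ ∀ S : Set Ell2, UniformlyIncluded S V →
    (⨆ z ∈ S, (‖f z‖ₑ + ∑' j : ℕ, (‖dz f j z‖ₑ ^ 2 + ‖dzbar f j z‖ₑ ^ 2))) < ⊤}

end EllTwo

end

open scoped ENNReal

namespace EllTwo

open Filter Topology Metric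

/-! ### Directional derivatives along lines -/

section LineDeriv

variable {E F : Type*} [NormedAddCommGroup E] [NormedSpace ℝ E]
  [NormedAddCommGroup F] [NormedSpace ℝ F]

/-! For `f` in C¹ the derivative along a finitely supported `v` is `D_v f = ∑ (Re v_j ∂f/∂x_j + Im
v_j ∂f/∂y_j)` (`hasLineDerivAt_trunc`). A bound `|D_v f| ≤ L‖v‖`, uniform over such `v`, amounts up
to constants to an ℓ² bound on the gradient: Cauchy–Schwarz gives one direction, testing on the
gradients of `Re f` and `Im f` the other. A Lipschitz constant bounds every `D_v f`. Conversely, the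
mean value inequality inside small balls bounds increments of `f` along truncations, and continuity
of `f` passes to the limit; since `S` need not be convex, distant points are handled by the bound on
`|f|`. Both arguments need room around `S`, given by `UniformlyIncluded.exists_thickening`. -/

theorem hasDerivAt_comp_line {f : E → F} {f' : F} {x v : E} {s : ℝ}
    (h : HasLineDerivAt ℝ f f' (x + s • v) v) :
    HasDerivAt (fun t : ℝ => f (x + t • v)) f' s := by
  have h' : HasDerivAt (fun t : ℝ => f (x + s • v + t • v)) f' (s - s) := by
    simpa [HasLineDerivAt] using h
  have := h'.comp_sub_const s s
  refine this.congr_of_eventuallyEq (Eventually.of_forall fun t => ?_)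
  simp only
  congr 1
  module

/-- Line derivatives are additive in the direction when one of them is continuous. -/
theorem hasLineDerivAt_add {f d d' : E → F} {u v : E} {V : Set E} (hV : IsOpen V)
    (hu : ∀ z ∈ V, HasLineDerivAt ℝ f (d z) z u) (hv : ∀ z ∈ V, HasLineDerivAt ℝ f (d' z) z v)
    (hd' : ContinuousOn d' V) {z : E} (hz : z ∈ V) :
    HasLineDerivAt ℝ f (d z + d' z) z (u + v) := by
  have key : HasDerivAt (fun t : ℝ => f (z + t • (u + v)) - f (z + t • u)) (d' z) 0 := by
    rw [hasDerivAt_iff_isLittleO, Asymptotics.isLittleO_iff]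
    intro ε hε
    have h1 : ∀ᶠ w in 𝓝 z, w ∈ V ∧ ‖d' w - d' z‖ ≤ ε := by
      refine Filter.Eventually.and (hV.mem_nhds hz) ?_
      have := (hd'.continuousAt (hV.mem_nhds hz)).eventually (closedBall_mem_nhds (d' z) hε)
      filter_upwards [this] with w hw
      simpa [dist_eq_norm] using hw
    obtain ⟨δ, hδ, hball⟩ := Metric.eventually_nhds_iff.1 h1
    have h2 : ∀ᶠ t : ℝ in 𝓝 0, |t| * (‖u‖ + ‖v‖) < δ := by
      have : Tendsto (fun t : ℝ => |t| * (‖u‖ + ‖v‖)) (𝓝 0) (𝓝 0) := by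
        have hc : Continuous (fun t : ℝ => |t| * (‖u‖ + ‖v‖)) := by fun_prop
        simpa using hc.tendsto 0
      exact this.eventually_lt_const hδ
    filter_upwards [h2] with t ht
    have hmem : ∀ s ∈ Set.uIcc 0 t, z + t • u + s • v ∈ V ∧
        ‖d' (z + t • u + s • v) - d' z‖ ≤ ε := by
      intro s hs
      apply hball
      have hst : |s| ≤ |t| := by simpa using Set.abs_sub_left_of_mem_uIcc hs
      calc dist (z + t • u + s • v) z = ‖t • u + s • v‖ := by
            rw [dist_eq_norm]; congr 1; abel
        _ ≤ |t| * ‖u‖ + |s| * ‖v‖ := by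
            refine (norm_add_le _ _).trans ?_
            simp [norm_smul]
        _ ≤ |t| * (‖u‖ + ‖v‖) := by rw [mul_add]; gcongr
        _ < δ := ht
    -- Subtracting `s • d' z` leaves a derivative of norm at most `ε` on the segment in direction
    -- `v`.
    have hmvt := (convex_uIcc (0 : ℝ) t).norm_image_sub_le_of_norm_hasDerivWithin_le
      (f := fun s : ℝ => f (z + t • u + s • v) - s • d' z)
      (f' := fun s => d' (z + t • u + s • v) - d' z) (C := ε) (x := 0) (y := t)
      (fun s hs => ((hasDerivAt_comp_line (hv _ (hmem s hs).1)).sub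
        (by simpa using (hasDerivAt_id s).smul_const (d' z))).hasDerivWithinAt)
      (fun s hs => (hmem s hs).2) Set.left_mem_uIcc Set.right_mem_uIcc
    simp only [zero_smul, add_zero, sub_zero, sub_self] at hmvt ⊢
    rwa [smul_add, ← add_assoc, sub_right_comm]
  have := (hu z hz).add key
  refine HasDerivAt.congr_of_eventuallyEq this (Eventually.of_forall fun t => ?_)
  simp

theorem hasLineDerivAt_sum {ι : Type*} {f : E → F} {d : ι → E → F} {u : ι → E} {V : Set E}
    (hV : IsOpen V) (s : Finset ι)
    (hu : ∀ i, ∀ z ∈ V, HasLineDerivAt ℝ f (d i z) z (u i))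
    (hd : ∀ i, ContinuousOn (d i) V) {z : E} (hz : z ∈ V) :
    HasLineDerivAt ℝ f (∑ i ∈ s, d i z) z (∑ i ∈ s, u i) := by
  classical
  induction s using Finset.induction_on generalizing z with
  | empty => simpa using hasLineDerivAt_zero
  | insert i s hi ih =>
    -- The new direction goes second, the slot where continuity of the derivative is required.
    rw [Finset.sum_insert hi, Finset.sum_insert hi, add_comm, add_comm (u i)]
    exact hasLineDerivAt_add hV (fun z hz => ih hz) (hu i) (hd i) hz

theorem norm_sub_le_of_hasLineDerivAt {f d : E → F} {x v : E} {C : ℝ}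
    (hd : ∀ t ∈ Set.Icc (0 : ℝ) 1, HasLineDerivAt ℝ f (d (x + t • v)) (x + t • v) v)
    (hC : ∀ t ∈ Set.Icc (0 : ℝ) 1, ‖d (x + t • v)‖ ≤ C) :
    ‖f (x + v) - f x‖ ≤ C := by
  simpa using (convex_Icc (0 : ℝ) 1).norm_image_sub_le_of_norm_hasDerivWithin_le
    (fun t ht => (hasDerivAt_comp_line (hd t ht)).hasDerivWithinAt) hC
    (Set.left_mem_Icc.2 zero_le_one) (Set.right_mem_Icc.2 zero_le_one)

end LineDeriv

/-! ### Gradients and finitely supported directions -/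

/-- The truncation of `v` to the coordinates in `F`. -/
noncomputable def trunc (F : Finset ℕ) (v : ℕ → ℂ) : Ell2 := ∑ j ∈ F, lp.single 2 j (v j)

theorem norm_trunc_sq (F : Finset ℕ) (v : ℕ → ℂ) : ‖trunc F v‖ ^ 2 = ∑ j ∈ F, ‖v j‖ ^ 2 := by
  have := lp.norm_sum_single (p := 2) (E := fun _ : ℕ => ℂ) (by simp) v F
  simpa [trunc] using this

theorem norm_trunc_le (F : Finset ℕ) (v : Ell2) : ‖trunc F v‖ ≤ ‖v‖ := by
  refine le_of_sq_le_sq ?_ (norm_nonneg _)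
  rw [norm_trunc_sq]
  simpa using lp.sum_rpow_le_norm_rpow (p := 2) (by simp) v F

theorem tendsto_trunc (v : Ell2) : Tendsto (fun F => trunc F v) atTop (𝓝 v) :=
  lp.hasSum_single (by simp) v

/-- The derivative of `f` at `z` in the direction of the truncation of `v` to `F`. -/
noncomputable def dirDeriv (f : Ell2 → ℂ) (F : Finset ℕ) (v : ℕ → ℂ) (z : Ell2) : ℂ :=
  ∑ j ∈ F, ((v j).re • partialX f j z + (v j).im • partialY f j z)

theorem hasLineDerivAt_trunc {V : Set Ell2} (hV : IsOpen V) {f : Ell2 → ℂ} (hf : f ∈ C1 V)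
    (F : Finset ℕ) (v : ℕ → ℂ) {z : Ell2} (hz : z ∈ V) :
    HasLineDerivAt ℝ f (dirDeriv f F v z) z (trunc F v) := by
  have hX : ∀ j, ∀ z ∈ V, HasLineDerivAt ℝ f ((v j).re • partialX f j z) z
      ((v j).re • lp.single 2 j (1 : ℂ)) := by
    intro j z hz
    refine HasLineDerivAt.smul ?_ _
    have := ((hf.2 j).1 z hz).1.hasDerivAt
    refine this.congr_of_eventuallyEq (Eventually.of_forall fun t => ?_)
    simp [sliceX, ← lp.single_smul]
  have hY : ∀ j, ∀ z ∈ V, HasLineDerivAt ℝ f ((v j).im • partialY f j z) z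
      ((v j).im • lp.single 2 j Complex.I) := by
    intro j z hz
    refine HasLineDerivAt.smul ?_ _
    have := ((hf.2 j).1 z hz).2.hasDerivAt
    refine this.congr_of_eventuallyEq (Eventually.of_forall fun t => ?_)
    simp [sliceY, ← lp.single_smul, mul_comm]
  have hsum : trunc F v = ∑ j ∈ F,
      ((v j).re • lp.single 2 j (1 : ℂ) + (v j).im • lp.single 2 j Complex.I) := by
    refine Finset.sum_congr rfl fun j _ => ?_
    rw [← lp.single_smul, ← lp.single_smul, ← lp.single_add]
    simp [Complex.re_add_im]
  rw [hsum]
  exact hasLineDerivAt_sum hV F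
    (fun j z hz => hasLineDerivAt_add hV (hX j) (hY j)
      (by have := (hf.2 j).2.2; fun_prop) hz)
    (fun j => by have := (hf.2 j).2.1; have := (hf.2 j).2.2; fun_prop) hz

theorem norm_sq_dz_add_norm_sq_dzbar (f : Ell2 → ℂ) (j : ℕ) (z : Ell2) :
    ‖dz f j z‖ ^ 2 + ‖dzbar f j z‖ ^ 2 = (‖partialX f j z‖ ^ 2 + ‖partialY f j z‖ ^ 2) / 2 := by
  simp only [dz, dzbar, Complex.sq_norm, Complex.normSq_apply]
  simp
  ring

/-- Cauchy–Schwarz applied to `∑ (∂_j f · v_j + ∂̄_j f · conj v_j)`; the factor 2 comes from `(a +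
b)² ≤ 2(a² + b²)`. -/
theorem norm_dirDeriv_le (f : Ell2 → ℂ) (F : Finset ℕ) (v : ℕ → ℂ) (z : Ell2) {M : ℝ}
    (hM : ∑ j ∈ F, (‖dz f j z‖ ^ 2 + ‖dzbar f j z‖ ^ 2) ≤ M) :
    ‖dirDeriv f F v z‖ ≤ √(2 * M) * ‖trunc F v‖ := by
  have hterm : ∀ j, ‖(v j).re • partialX f j z + (v j).im • partialY f j z‖ ≤
      (‖dz f j z‖ + ‖dzbar f j z‖) * ‖v j‖ := by
    intro j
    have : (v j).re • partialX f j z + (v j).im • partialY f j z =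
        dz f j z * v j + dzbar f j z * (starRingEnd ℂ) (v j) := by
      conv_rhs => rw [← Complex.re_add_im (v j)]
      simp only [dz, dzbar, Complex.real_smul, map_add, map_mul, Complex.conj_ofReal,
        Complex.conj_I]
      linear_combination (v j).im * partialY f j z * Complex.I_sq
    rw [this, add_mul]
    refine (norm_add_le _ _).trans ?_
    simp
  refine le_of_sq_le_sq ?_ (by positivity)
  have hM0 : 0 ≤ M := (Finset.sum_nonneg fun j _ => add_nonneg (sq_nonneg _) (sq_nonneg _)).trans hM
  rw [mul_pow, Real.sq_sqrt (by positivity), norm_trunc_sq]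
  calc ‖dirDeriv f F v z‖ ^ 2
      ≤ (∑ j ∈ F, (‖dz f j z‖ + ‖dzbar f j z‖) * ‖v j‖) ^ 2 := by
        gcongr
        exact (norm_sum_le _ _).trans (Finset.sum_le_sum fun j _ => hterm j)
    _ ≤ (∑ j ∈ F, (‖dz f j z‖ + ‖dzbar f j z‖) ^ 2) * ∑ j ∈ F, ‖v j‖ ^ 2 :=
        Finset.sum_mul_sq_le_sq_mul_sq _ _ _
    _ ≤ (2 * M) * ∑ j ∈ F, ‖v j‖ ^ 2 := by
        gcongr
        refine le_trans ?_ (mul_le_mul_of_nonneg_left hM zero_le_two)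
        rw [Finset.mul_sum]
        exact Finset.sum_le_sum fun j _ => add_sq_le

/-- A bound on all finitely supported directional derivatives bounds the gradient. -/
theorem sum_norm_sq_le_of_norm_dirDeriv_le {f : Ell2 → ℂ} {F : Finset ℕ} {z : Ell2} {C : ℝ}
    (h : ∀ v, ‖dirDeriv f F v z‖ ≤ C * ‖trunc F v‖) :
    ∑ j ∈ F, (‖dz f j z‖ ^ 2 + ‖dzbar f j z‖ ^ 2) ≤ C ^ 2 := by
  have aux : ∀ v : ℕ → ℂ, ‖trunc F v‖ ^ 2 ≤ ‖dirDeriv f F v z‖ → ‖trunc F v‖ ^ 2 ≤ C ^ 2 := by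
    intro v hv
    have h1 := hv.trans (h v)
    rcases (norm_nonneg (trunc F v)).eq_or_lt with h0 | h0
    · rw [← h0, zero_pow two_ne_zero]; positivity
    · have : ‖trunc F v‖ ≤ C := by nlinarith
      gcongr
  -- The test vector is the truncated real gradient of `Re f`, so `Re (D_v f) = ‖v‖²`; next, the
  -- same for `Im f`.
  have hre := aux (fun j => ⟨(partialX f j z).re, (partialY f j z).re⟩) (by
    refine le_trans (le_of_eq ?_) (Complex.re_le_norm _)
    simp [norm_trunc_sq, dirDeriv, Complex.sq_norm, Complex.normSq_apply])
  have him := aux (fun j => ⟨(partialX f j z).im, (partialY f j z).im⟩) (by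
    refine le_trans (le_of_eq ?_) ((le_abs_self _).trans (Complex.abs_im_le_norm _))
    simp [norm_trunc_sq, dirDeriv, Complex.sq_norm, Complex.normSq_apply])
  rw [norm_trunc_sq] at hre him
  calc ∑ j ∈ F, (‖dz f j z‖ ^ 2 + ‖dzbar f j z‖ ^ 2)
      = (∑ j ∈ F, ‖(⟨(partialX f j z).re, (partialY f j z).re⟩ : ℂ)‖ ^ 2 +
          ∑ j ∈ F, ‖(⟨(partialX f j z).im, (partialY f j z).im⟩ : ℂ)‖ ^ 2) / 2 := by
        rw [← Finset.sum_add_distrib, Finset.sum_div]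
        refine Finset.sum_congr rfl fun j _ => ?_
        rw [norm_sq_dz_add_norm_sq_dzbar]
        simp only [Complex.sq_norm, Complex.normSq_apply]
        ring
    _ ≤ C ^ 2 := by linarith


/-! ### Geometry of uniformly included sets -/

/-- A ball is connected, so one that meets `V` but misses its frontier cannot also meet the
complement of `V`. -/
theorem ball_subset_of_lt_distToFrontier {S V : Set Ell2} (hSV : S ⊆ V) {r : ℝ}
    (hr : ENNReal.ofReal r ≤ distToFrontier S V) {z : Ell2} (hz : z ∈ S) : ball z r ⊆ V := by
  rcases le_or_gt r 0 with h0 | h0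
  · simp [ball_eq_empty.2 h0]
  have hdisj : Disjoint (frontier V) (ball z r) := by
    rw [Set.disjoint_left]
    intro w hw hwz
    have h1 : distToFrontier S V ≤ edist z w := iInf₂_le_of_le z hz (iInf₂_le w hw)
    have h2 := hr.trans h1
    rw [edist_dist, ENNReal.ofReal_le_ofReal_iff dist_nonneg, dist_comm] at h2
    exact absurd (mem_ball.1 hwz) (not_lt.2 h2)
  have hconn : IsPreconnected (ball z r) := (convex_ball z r).isPreconnected
  by_contra hsub
  obtain ⟨w, hw, hwV⟩ := Set.not_subset.1 hsub
  obtain ⟨y, hy, hy'⟩ := hconn (interior V) (closure V)ᶜ isOpen_interior isClosed_closure.isOpen_compl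
    (fun y hy => by
      by_cases h : y ∈ closure V
      · left
        by_contra h'
        exact Set.disjoint_left.1 hdisj ⟨h, h'⟩ hy
      · exact Or.inr h)
    ⟨z, mem_ball_self h0, by
      by_contra h'
      exact Set.disjoint_left.1 hdisj ⟨subset_closure (hSV hz), h'⟩ (mem_ball_self h0)⟩
    ⟨w, hw, fun h => Set.disjoint_left.1 hdisj ⟨h, fun h' => hwV (interior_subset h')⟩ hw⟩
  exact hy'.2 (subset_closure (interior_subset hy'.1))

/-- Some open thickening of a uniformly included set is again uniformly included. -/
theorem UniformlyIncluded.exists_thickening {S V : Set Ell2} (h : UniformlyIncluded S V) :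
    ∃ r > 0, UniformlyIncluded (thickening r S) V := by
  obtain ⟨hne, hbd, hSV, hpos⟩ := h
  obtain ⟨ρ, hρ, hρd⟩ := ENNReal.lt_iff_exists_nnreal_btwn.1 hpos
  have hρ0 : (0 : ℝ) < ρ := by exact_mod_cast hρ
  -- Half of `ρ` is spent on the thickening; the triangle inequality keeps the other half as
  -- distance to the frontier.
  refine ⟨ρ / 2, by positivity, hne.mono (self_subset_thickening (by positivity) S),
    hbd.thickening, ?_, ?_⟩
  · intro w hw
    obtain ⟨z, hz, hwz⟩ := mem_thickening_iff.1 hw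
    refine ball_subset_of_lt_distToFrontier hSV (r := ρ) (by simpa using hρd.le) hz ?_
    exact mem_ball.2 (by linarith)
  · refine lt_of_lt_of_le (b := ENNReal.ofReal (ρ / 2)) (by simpa using hρ0) ?_
    refine le_iInf₂ fun w hw => le_iInf₂ fun y hy => ?_
    obtain ⟨z, hz, hwz⟩ := mem_thickening_iff.1 hw
    have h1 : distToFrontier S V ≤ edist z y := iInf₂_le_of_le z hz (iInf₂_le y hy)
    have h2 : ENNReal.ofReal ρ ≤ edist z y := le_trans (by simpa using hρd.le) h1
    rw [edist_dist, ENNReal.ofReal_le_ofReal_iff dist_nonneg] at h2 ⊢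
    have := dist_triangle_left z y w
    linarith

theorem tsum_le_iff_sum_norm_le (f : Ell2 → ℂ) (z : Ell2) {M : ℝ} (hM : 0 ≤ M) :
    ∑' j : ℕ, (‖dz f j z‖ₑ ^ 2 + ‖dzbar f j z‖ₑ ^ 2) ≤ ENNReal.ofReal M ↔
      ∀ F : Finset ℕ, ∑ j ∈ F, (‖dz f j z‖ ^ 2 + ‖dzbar f j z‖ ^ 2) ≤ M := by
  have h : ∀ j, ‖dz f j z‖ₑ ^ 2 + ‖dzbar f j z‖ₑ ^ 2 =
      ENNReal.ofReal (‖dz f j z‖ ^ 2 + ‖dzbar f j z‖ ^ 2) := by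
    intro j
    rw [ENNReal.ofReal_add (by positivity) (by positivity), ENNReal.ofReal_pow (norm_nonneg _),
      ENNReal.ofReal_pow (norm_nonneg _), ofReal_norm, ofReal_norm]
  simp_rw [h]
  rw [ENNReal.tsum_eq_iSup_sum, iSup_le_iff]
  refine forall_congr' fun F => ?_
  rw [← ENNReal.ofReal_sum_of_nonneg fun _ _ => by positivity,
    ENNReal.ofReal_le_ofReal_iff hM]

/-! ### The two inclusions -/

theorem mem_C1F_of_mem_LipUI {V : Set Ell2} (hV : IsOpen V) {f : Ell2 → ℂ} (hf : f ∈ C1 V)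
    (hL : f ∈ LipUI V) : f ∈ C1F V := by
  refine ⟨hf, fun S hS => ?_⟩
  obtain ⟨r, hr, hT⟩ := hS.exists_thickening
  obtain ⟨C, hC, hlip⟩ := hL _ hT
  have hST := self_subset_thickening hr S
  obtain ⟨z₀, hz₀⟩ := hS.1
  obtain ⟨D, hD⟩ := isBounded_iff.1 hS.2.1
  have hbound : ∀ z ∈ S, ‖f z‖ₑ + ∑' j : ℕ, (‖dz f j z‖ₑ ^ 2 + ‖dzbar f j z‖ₑ ^ 2) ≤
      ENNReal.ofReal (‖f z₀‖ + C * D) + ENNReal.ofReal (C ^ 2) := by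
    intro z hz
    refine add_le_add ?_ ((tsum_le_iff_sum_norm_le f z (by positivity)).2 fun F =>
      sum_norm_sq_le_of_norm_dirDeriv_le fun v => ?_)
    · rw [← ofReal_norm]
      refine ENNReal.ofReal_le_ofReal ?_
      have h1 := hlip z (hST hz) z₀ (hST hz₀)
      have h2 : C * ‖z - z₀‖ ≤ C * D := by
        rw [← dist_eq_norm]
        exact mul_le_mul_of_nonneg_left (hD hz hz₀) hC.le
      have h3 := norm_sub_norm_le (f z) (f z₀)
      linarith
    -- The Lipschitz bound must hold on a neighbourhood of `z`; the thickening is one, while `S`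
    -- need not be.
    · refine (hasLineDerivAt_trunc hV hf F v (hS.2.2.1 hz)).le_of_lip' hC.le ?_
      filter_upwards [isOpen_thickening.mem_nhds (hST hz)] with w hw using hlip w hw z (hST hz)
  exact (iSup₂_le hbound).trans_lt (by simp)

/-- A `C¹` function whose gradient is bounded on a ball is Lipschitz at its center. -/
theorem norm_sub_le_of_gradient_le {V : Set Ell2} (hV : IsOpen V) {f : Ell2 → ℂ} (hf : f ∈ C1 V)
    {z w : Ell2} {r M : ℝ} (hball : ball z r ⊆ V)
    (hM : ∀ y ∈ ball z r, ∀ F : Finset ℕ, ∑ j ∈ F, (‖dz f j y‖ ^ 2 + ‖dzbar f j y‖ ^ 2) ≤ M)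
    (hw : w ∈ ball z r) : ‖f w - f z‖ ≤ √(2 * M) * ‖w - z‖ := by
  have htrunc : ∀ F : Finset ℕ, ‖f (z + trunc F (w - z : Ell2)) - f z‖ ≤ √(2 * M) * ‖w - z‖ := by
    intro F
    have hle := norm_trunc_le F (w - z)
    -- Truncation does not increase the norm, so these segments stay in the ball even though they
    -- end away from `w`.
    have hmem : ∀ t ∈ Set.Icc (0 : ℝ) 1, z + t • trunc F (w - z : Ell2) ∈ ball z r := by
      intro t ht
      rw [mem_ball, dist_eq_norm] at hw ⊢
      rw [add_sub_cancel_left, norm_smul, Real.norm_of_nonneg ht.1]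
      exact ((mul_le_of_le_one_left (norm_nonneg _) ht.2).trans hle).trans_lt hw
    refine norm_sub_le_of_hasLineDerivAt (d := dirDeriv f F (w - z : Ell2))
      (fun t ht => hasLineDerivAt_trunc hV hf F _ (hball (hmem t ht))) fun t ht => ?_
    exact (norm_dirDeriv_le f F _ _ (hM _ (hmem t ht) F)).trans (by gcongr)
  have hlim : Tendsto (fun F => z + trunc F (w - z : Ell2)) atTop (𝓝 w) := by
    simpa using (tendsto_trunc (w - z)).const_add z
  have hcont : ContinuousAt f w := hf.1.continuousAt (hV.mem_nhds (hball hw))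
  exact le_of_tendsto ((hcont.tendsto.comp hlim).sub_const (f z)).norm (Eventually.of_forall htrunc)

theorem mem_LipUI_of_mem_C1F {V : Set Ell2} (hV : IsOpen V) {f : Ell2 → ℂ} (hf : f ∈ C1F V) :
    f ∈ LipUI V := by
  intro S hS
  obtain ⟨r, hr, hT⟩ := hS.exists_thickening
  have hST := self_subset_thickening hr S
  have hfin := hf.2 _ hT
  set K := ⨆ z ∈ thickening r S, (‖f z‖ₑ + ∑' j : ℕ, (‖dz f j z‖ₑ ^ 2 + ‖dzbar f j z‖ₑ ^ 2))
  have hK : ∀ z ∈ thickening r S,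
      ‖f z‖ₑ + ∑' j : ℕ, (‖dz f j z‖ₑ ^ 2 + ‖dzbar f j z‖ₑ ^ 2) ≤ ENNReal.ofReal K.toReal := by
    intro z hz
    rw [ENNReal.ofReal_toReal hfin.ne]
    exact le_iSup₂_of_le z hz le_rfl
  set M := K.toReal
  have hM : 0 ≤ M := ENNReal.toReal_nonneg
  have hf_le : ∀ z ∈ S, ‖f z‖ ≤ M := by
    intro z hz
    have := le_self_add.trans (hK z (hST hz))
    rwa [← ofReal_norm, ENNReal.ofReal_le_ofReal_iff hM] at this
  have hsum : ∀ z ∈ thickening r S, ∀ F : Finset ℕ,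
      ∑ j ∈ F, (‖dz f j z‖ ^ 2 + ‖dzbar f j z‖ ^ 2) ≤ M := fun z hz =>
    (tsum_le_iff_sum_norm_le f z hM).1 (le_add_self.trans (hK z hz))
  -- The first term serves pairs at distance below `r`, the second the remaining pairs via `|f| ≤
  -- M`; the 1 ensures positivity.
  refine ⟨√(2 * M) + 2 * M / r + 1, by positivity, fun w hw z hz => ?_⟩
  have h1 : 0 ≤ √(2 * M) * ‖w - z‖ := by positivity
  have h2 : 0 ≤ 2 * M / r * ‖w - z‖ := by positivity
  have h3 := norm_nonneg (w - z)
  rcases lt_or_ge ‖w - z‖ r with hlt | hge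
  · have hsub := ball_subset_thickening hz r
    have := norm_sub_le_of_gradient_le hV hf.1 (hsub.trans hT.2.2.1)
      (fun y hy => hsum y (hsub hy)) (w := w) (by rwa [mem_ball, dist_eq_norm])
    linarith
  · have h4 : 2 * M ≤ 2 * M / r * ‖w - z‖ := by
      rw [div_mul_eq_mul_div, le_div_iff₀ hr]
      gcongr
    have h5 := norm_sub_le (f w) (f z)
    linarith [hf_le w hw, hf_le z hz]

end EllTwo

theorem proposition3p4 (V : Set EllTwo.Ell2) (hV : IsOpen V) :
    EllTwo.C1 V ∩ EllTwo.LipUI V = EllTwo.C1F V :=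
  Set.Subset.antisymm (fun _ hf => EllTwo.mem_C1F_of_mem_LipUI hV hf.1 hf.2)
    fun _ hf => ⟨hf.1, EllTwo.mem_LipUI_of_mem_C1F hV hf⟩
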